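/- **Setting.** Let $\mathcal X$ be a measurable space, $n\in\mathbb N$, $\mathbf P$ a probability distribution on $\mathcal X^n$ (not necessarily a product), and $\gamma_n:(0,\infty)\to[0,\infty)$ a non-decreasing function. Let $Q_{\gamma_n}(\mathbf P)$ be the class of $\gamma_n$-concentrated queries, i.e. of all measurable $\mathbf P$-integrable $q:\mathcal X^n\to\mathbb R$ with $$\Pr_{\mathbf X\sim\mathbf P}\Big[\big|q(\mathbf X)-\mathbb E_{\mathbf Y\sim\mathbf P}\,q(\mathbf Y)\big|>t\Big]<e^{-\gamma_n(t)}\qquad\text{for all } t>0 .$$ The *Laplace mechanism* with parameters $\eta,\nu>0$ chooses a width $r>0$ with $\gamma_n(r)\ge\ln(1/\nu)$ and answers a query $q$ on a dataset $\mathbf x\in\mathcal X^n$ by $q(\mathbf x)+N$, where $N$ is fresh noise from the Laplace distribution of scale $r/\eta$ (density $z\mapsto\frac{\eta}{2r}e^{-\eta|z|/r}$). In the *adaptive procedure*, a dataset $\mathbf X\sim\mathbf P$ is drawn once; in round $j=1,\dots,k$ an arbitrary, possibly randomized analyst (whose coins are independent of $\mathbf X$ and of the noise) chooses $q_j\in Q_{\gamma_n}(\mathbf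 P)$ (measurably) on the basis of its coins and of $q_1,w_1,\dots,q_{j-1},w_{j-1}$, and receives the Laplace mechanism's answer $w_j$ to $q_j$ on $\mathbf X$. **Theorem.** There is an absolute constant $c_0>0$ such that for all $c_1\ge c_0$ and $K\ge 1$ there are constants $C,c>0$, depending only on $c_1$ and $K$, with the following property. Let $\mathcal X,n,\mathbf P,\gamma_n$ be as above, let $k\ge1$, $\alpha>0$, $0<\beta<1$, and put $$a=\frac{\alpha}{\sqrt k\,\ln^{3/2}(k/\beta)} .$$ Run the adaptive procedure for $k$ queries with the Laplace mechanism, with parameters satisfying $$\frac{c_0}{\sqrt{k\ln(k/\beta)}}\le\eta\le\frac{c_1}{\sqrt{k\ln(k/\beta)}},\qquad 0<\nu\le K e^{-\gamma_n(a)},$$ and with an admissible width $r\le a$ (that is, $0<r\le a$ and $\gamma_n(r)\ge\ln(1/\nu)$), the same in all rounds. Then, for every analyst, $$\Pr\Big[\max_{1\le j\le k}\big|\mathbb E_{\mathbf Y\sim\mathbf P}\,q_j(\mathbf Y)-w_j\big|\ge\alpha\Big]\le C\Big(k^{3/4}\ln^{1/4}(k/\beta)\,e^{-c\,\gamma_n(a)}+\beta\Big),$$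 where the probability is over $\mathbf X$, the coins of the analyst and the noise of the mechanism. -/

import Mathlib

open MeasureTheory

universe u v

noncomputable section

namespace TypicalStability

/-- Datasets of `n` elements of the data domain `𝒳`. -/
abbrev Dataset (n : ℕ) (𝒳 : Type u) : Type u := Fin n → 𝒳

/-- The class `Q_γ(P)` of `γ`-concentrated queries with respect to the distribution `P`: the
(measurable) real-valued queries that have an expected value under `P` and satisfy
`Pr_{X ∼ P}[|q(X) - E_{Y ∼ P} q(Y)| > t] < e^{-γ(t)}` for every `t > 0`. -/
def concentratedQueries {n : ℕ} {𝒳 : Type u} [MeasurableSpace 𝒳]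
    (P : Measure (Dataset n 𝒳)) (γ : ℝ → ℝ) : Set (Dataset n 𝒳 → ℝ) :=
  {q | Measurable q ∧ Integrable q P ∧
    ∀ t : ℝ, 0 < t → P.real {x | t < |q x - ∫ y, q y ∂P|} < Real.exp (-γ t)}

/-- The Laplace distribution `Lap(b)` (centred, scale `b > 0`), of density
`z ↦ (2b)⁻¹ e^{-|z|/b}`. -/
def laplaceMeasure (b : ℝ) : Measure ℝ :=
  volume.withDensity fun z => ENNReal.ofReal ((2 * b)⁻¹ * Real.exp (-|z| / b))

/-- The widths that the Laplace mechanism may choose in its first step, given the function `γ`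
and the parameter `ν`: those `r > 0` with `γ(r) ≥ ln(1/ν)`. -/
def IsAdmissibleWidth (γ : ℝ → ℝ) (ν r : ℝ) : Prop :=
  0 < r ∧ Real.log (1 / ν) ≤ γ r

/-- The answer of the Laplace mechanism to the query `q` on the dataset `x`, when `N` is the
noise that it has drawn. -/
def laplaceAnswer {n : ℕ} {𝒳 : Type u} (x : Dataset n 𝒳) (q : Dataset n 𝒳 → ℝ) (N : ℝ) : ℝ :=
  q x + N

/-- An adaptive, possibly randomized analyst that asks `k` queries from `Q_γ(P)`.  Its coins are
an element `s` of the measurable space `S`.  In round `j` (counted from `0`) it has received the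
answers `w 0, …, w (j - 1)` and submits the query `query j s w`.  The earlier queries are functions
of `s` and of the earlier answers, so the choice may depend on them too. -/
structure Analyst {n : ℕ} {𝒳 : Type u} [MeasurableSpace 𝒳]
    (P : Measure (Dataset n 𝒳)) (γ : ℝ → ℝ) (k : ℕ) (S : Type v) [MeasurableSpace S] where
  query : (j : Fin k) → S → (Fin j → ℝ) → Dataset n 𝒳 → ℝ
  query_mem : ∀ j s w, query j s w ∈ concentratedQueries P γ
  measurable_query : ∀ j : Fin k, Measurable
    fun p : S × (Fin j → ℝ) × Dataset n 𝒳 => query j p.1 p.2.1 p.2.2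

namespace Analyst

variable {n : ℕ} {𝒳 : Type u} [MeasurableSpace 𝒳] {P : Measure (Dataset n 𝒳)} {γ : ℝ → ℝ}
  {k : ℕ} {S : Type v} [MeasurableSpace S]

/-- The first `m` answers of the interaction between the analyst `A` with coins `s` and the Laplace
mechanism on the dataset `x`, where `N j` is the noise that the mechanism draws in round `j`. -/
def history (A : Analyst P γ k S) (x : Dataset n 𝒳) (s : S) (N : Fin k → ℝ) :
    (m : ℕ) → m ≤ k → Fin m → ℝ
  | 0, _ => Fin.elim0
  | m + 1, h =>
      let w := history A x s N m (Nat.le_of_succ_le h)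
      Fin.snoc w (laplaceAnswer x (A.query ⟨m, h⟩ s w) (N ⟨m, h⟩))

/-- The query `q_j` submitted in round `j`. -/
def chosenQuery (A : Analyst P γ k S) (x : Dataset n 𝒳) (s : S) (N : Fin k → ℝ) (j : Fin k) :
    Dataset n 𝒳 → ℝ :=
  A.query j s (A.history x s N j j.isLt.le)

/-- The answer `w_j` of the mechanism in round `j`. -/
def answer (A : Analyst P γ k S) (x : Dataset n 𝒳) (s : S) (N : Fin k → ℝ) (j : Fin k) : ℝ :=
  laplaceAnswer x (A.chosenQuery x s N j) (N j)

/-- The worst true error `max_j |E_{Y ∼ P} q_j(Y) - w_j|` of the interaction. -/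
def worstTrueError (A : Analyst P γ k S) (x : Dataset n 𝒳) (s : S) (N : Fin k → ℝ) : ℝ :=
  ⨆ j : Fin k, |(∫ y, A.chosenQuery x s N j y ∂P) - A.answer x s N j|

end Analyst

/-- The joint law of all the randomness of the interaction: the dataset, the coins of the analyst
(of law `ρ`), and the `k` noises of scale `b`, all independent. -/
def interactionMeasure {n : ℕ} {𝒳 : Type u} [MeasurableSpace 𝒳] (P : Measure (Dataset n 𝒳))
    {S : Type v} [MeasurableSpace S] (ρ : Measure S) (k : ℕ) (b : ℝ) :
    Measure (Dataset n 𝒳 × S × (Fin k → ℝ)) :=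
  P.prod (ρ.prod (Measure.pi fun _ : Fin k => laplaceMeasure b))

/-- The quantity `α / (√k · ln^{3/2}(k/β))`. -/
def scaledAccuracy (α β : ℝ) (k : ℕ) : ℝ :=
  α / (Real.sqrt k * Real.log (k / β) ^ (3 / 2 : ℝ))

end TypicalStability

end

namespace TypicalStability

open scoped ENNReal

/-! Three processes share the same noise and differ only in how it is shifted: by the value of the
query on the dataset (the real one), by that value clamped to within `r` of its mean, or by the mean
itself (the ideal one). The real and clamped processes coincide unless some query deviates by more
than `r` along the clamped history. The shifts of the clamped and ideal processes differ by at most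
`r`, so each Laplace round multiplies the second moment of the likelihood ratio by at most `1 + (e^η
- 1)²`. As `kη²` is bounded, `k` rounds cost only a constant `M`, and Cauchy–Schwarz gives
`Pr_clamped[deviation]² ≤ M · Pr_ideal[deviation]` (`lintegral_shiftHistory_sq_le`). Ideal answers
carry no information on the dataset, so a union bound yields `kν` there
(`lintegral_deviation_independent_le`).

Without deviation, an error of `α` forces a noise of size `α/2` (`le_worstTrueError_subset`), which
has probability at most `2β`. The total is of order `√k e^{-γ(a)/2} + β`, slightly better than
claimed. -/

/-! ### Cauchy–Schwarz for lower integrals -/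

theorem lintegral_mul_sq_le {Ω : Type*} [MeasurableSpace Ω] (μ : Measure Ω) {f g : Ω → ℝ≥0∞}
    (hf : AEMeasurable f μ) (hg : AEMeasurable g μ) :
    (∫⁻ x, f x * g x ∂μ) ^ 2 ≤ (∫⁻ x, f x ^ 2 ∂μ) * ∫⁻ x, g x ^ 2 ∂μ := by
  have h := ENNReal.lintegral_mul_le_Lp_mul_Lq μ Real.HolderConjugate.two_two hf hg
  have hsq : ∀ a : ℝ≥0∞, (a ^ (1 / (2 : ℝ))) ^ 2 = a := fun a => by
    rw [← ENNReal.rpow_natCast, ← ENNReal.rpow_mul]; norm_num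
  calc (∫⁻ x, f x * g x ∂μ) ^ 2
      ≤ ((∫⁻ x, f x ^ (2 : ℝ) ∂μ) ^ (1 / (2 : ℝ)) *
          (∫⁻ x, g x ^ (2 : ℝ) ∂μ) ^ (1 / (2 : ℝ))) ^ 2 := by
        gcongr
        exact h
    _ = _ := by rw [mul_pow, hsq, hsq]; simp only [ENNReal.rpow_two]

theorem lintegral_sq_le {Ω : Type*} [MeasurableSpace Ω] (μ : Measure Ω) [IsProbabilityMeasure μ]
    {f : Ω → ℝ≥0∞} (hf : AEMeasurable f μ) : (∫⁻ x, f x ∂μ) ^ 2 ≤ ∫⁻ x, f x ^ 2 ∂μ := by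
  simpa using lintegral_mul_sq_le μ hf (aemeasurable_const (b := 1))

/-! ### The Laplace distribution -/

theorem lintegral_exp_neg_abs_div {b : ℝ} (hb : 0 < b) :
    ∫⁻ z : ℝ, ENNReal.ofReal (Real.exp (-|z| / b)) = ENNReal.ofReal (2 * b) := by
  have hneg : -b⁻¹ < 0 := by simpa using hb
  have heq : (fun z : ℝ => Real.exp (-|z| / b)) = fun z => Real.exp (-b⁻¹ * |z|) := by
    funext z; congr 1; field_simp
  have hval : ∫ z : ℝ, Real.exp (-|z| / b) = 2 * b := by
    rw [heq, integral_comp_abs (f := fun z => Real.exp (-b⁻¹ * z)), integral_exp_mul_Ioi hneg]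
    simp
  rw [← hval, ofReal_integral_eq_lintegral_ofReal]
  -- A non-integrable function would have Bochner integral `0`, not `2b`.
  · by_contra h
    rw [integral_undef h] at hval
    linarith
  · exact .of_forall fun z => (Real.exp_pos _).le

theorem measurable_laplaceDensity (b : ℝ) :
    Measurable fun z : ℝ => ENNReal.ofReal ((2 * b)⁻¹ * Real.exp (-|z| / b)) := by
  fun_prop

theorem lintegral_laplaceMeasure (b : ℝ) {g : ℝ → ℝ≥0∞} (hg : Measurable g) :
    ∫⁻ z, g z ∂laplaceMeasure b =
      ∫⁻ z, ENNReal.ofReal ((2 * b)⁻¹ * Real.exp (-|z| / b)) * g z :=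
  lintegral_withDensity_eq_lintegral_mul _ (measurable_laplaceDensity b) hg

theorem isProbabilityMeasure_laplaceMeasure {b : ℝ} (hb : 0 < b) :
    IsProbabilityMeasure (laplaceMeasure b) := by
  constructor
  have h := lintegral_laplaceMeasure b (g := 1) measurable_one
  simp only [Pi.one_apply, lintegral_one, mul_one] at h
  rw [h]
  simp_rw [ENNReal.ofReal_mul (inv_nonneg.2 (mul_pos two_pos hb).le)]
  rw [lintegral_const_mul _ (by fun_prop), lintegral_exp_neg_abs_div hb,
    ← ENNReal.ofReal_mul (by positivity), inv_mul_cancel₀ (by positivity), ENNReal.ofReal_one]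

/-- Markov's inequality for `e^{|z|/(2b)}`, whose mean is `2`. -/
theorem laplaceMeasure_abs_ge_le {b : ℝ} (hb : 0 < b) (t : ℝ) :
    laplaceMeasure b {z | t ≤ |z|} ≤ ENNReal.ofReal (2 * Real.exp (-t / (2 * b))) := by
  have hset : MeasurableSet {z : ℝ | t ≤ |z|} := measurableSet_le measurable_const (by fun_prop)
  have hmain : ∫⁻ z, ENNReal.ofReal (Real.exp (|z| / (2 * b))) ∂laplaceMeasure b =
      ENNReal.ofReal 2 := by
    rw [lintegral_laplaceMeasure b (by fun_prop)]
    have : ∀ z : ℝ, ENNReal.ofReal ((2 * b)⁻¹ * Real.exp (-|z| / b)) *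
        ENNReal.ofReal (Real.exp (|z| / (2 * b))) =
        ENNReal.ofReal (2 * b)⁻¹ * ENNReal.ofReal (Real.exp (-|z| / (2 * b))) := fun z => by
      rw [← ENNReal.ofReal_mul (by positivity), ← ENNReal.ofReal_mul (by positivity), mul_assoc,
        ← Real.exp_add]
      congr 3
      field_simp
      ring
    simp_rw [this]
    rw [lintegral_const_mul _ (by fun_prop), lintegral_exp_neg_abs_div (by positivity),
      ← ENNReal.ofReal_mul (by positivity)]
    congr 1
    field_simp
  calc laplaceMeasure b {z | t ≤ |z|}
      = ∫⁻ z, Set.indicator {z | t ≤ |z|} 1 z ∂laplaceMeasure b := by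
        rw [lintegral_indicator_one hset]
    _ ≤ ∫⁻ z, ENNReal.ofReal (Real.exp (-t / (2 * b))) *
          ENNReal.ofReal (Real.exp (|z| / (2 * b))) ∂laplaceMeasure b := by
        refine lintegral_mono fun z => ?_
        by_cases hz : z ∈ {z : ℝ | t ≤ |z|}
        swap
        · simp [Set.indicator_of_notMem hz]
        rw [Set.indicator_of_mem hz]
        rw [← ENNReal.ofReal_mul (by positivity), ← Real.exp_add, ← add_div, Pi.one_apply,
          ENNReal.one_le_ofReal, Real.one_le_exp_iff]
        have : t ≤ |z| := hz
        exact div_nonneg (by linarith) (by positivity)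
    _ = _ := by
        rw [lintegral_const_mul _ (by fun_prop), hmain, ← ENNReal.ofReal_mul (by positivity),
          mul_comm]

/-- The likelihood ratio of two Laplace distributions of scale `r / η` whose centres differ by at
most `r` has second moment at most `1 + (e^η - 1)²`. -/
theorem lintegral_laplace_ratio_sq_le {r η d : ℝ} (hr : 0 < r) (hη : 0 < η) (hd : |d| ≤ r) :
    ∫⁻ z, ENNReal.ofReal (Real.exp ((|z| - |z - d|) / (r / η))) ^ 2 ∂laplaceMeasure (r / η) ≤
      ENNReal.ofReal (1 + (Real.exp η - 1) ^ 2) := by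
  have hb : 0 < r / η := div_pos hr hη
  have := isProbabilityMeasure_laplaceMeasure hb
  set b := r / η with hbdef
  have hone : ∫⁻ z, ENNReal.ofReal (Real.exp ((|z| - |z - d|) / b)) ∂laplaceMeasure b = 1 := by
    rw [lintegral_laplaceMeasure b (by fun_prop)]
    have : ∀ z : ℝ, ENNReal.ofReal ((2 * b)⁻¹ * Real.exp (-|z| / b)) *
        ENNReal.ofReal (Real.exp ((|z| - |z - d|) / b)) =
        ENNReal.ofReal ((2 * b)⁻¹ * Real.exp (-|z - d| / b)) := fun z => by
      rw [← ENNReal.ofReal_mul (by positivity), mul_assoc, ← Real.exp_add]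
      congr 3
      ring
    simp_rw [this]
    rw [lintegral_sub_right_eq_self
      (fun z => ENNReal.ofReal ((2 * b)⁻¹ * Real.exp (-|z| / b))) d]
    have h := lintegral_laplaceMeasure b (g := 1) measurable_one
    simpa using h.symm
  -- For the ratio `X`, this is `(X - 1)² ≤ (e^η - 1)²`, rearranged to avoid subtraction. Since `X`
  -- has mean `1`, the first-order term in `η` vanishes on integrating.
  have hpt : ∀ z : ℝ, ENNReal.ofReal (Real.exp ((|z| - |z - d|) / b)) ^ 2 + 1 ≤
      ENNReal.ofReal ((Real.exp η - 1) ^ 2) +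
        2 * ENNReal.ofReal (Real.exp ((|z| - |z - d|) / b)) := fun z => by
    set x := (|z| - |z - d|) / b with hx
    have hxη : |x| ≤ η := by
      rw [hx, abs_div, abs_of_pos hb, div_le_iff₀ hb, hbdef, mul_div_cancel₀ _ hη.ne']
      refine (abs_abs_sub_abs_le _ _).trans ?_
      simpa using hd
    have h1 : Real.exp x ≤ Real.exp η := Real.exp_le_exp.2 (le_of_abs_le hxη)
    have h2 : 1 - (Real.exp η - 1) ≤ Real.exp x := by
      have h3 : Real.exp (-η) ≤ Real.exp x := Real.exp_le_exp.2 (neg_le_of_abs_le hxη)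
      have h4 : 1 ≤ Real.exp η * Real.exp (-η) := by rw [← Real.exp_add]; simp
      nlinarith [Real.exp_pos η, Real.exp_pos (-η), sq_nonneg (Real.exp η - Real.exp (-η)),
        Real.add_one_le_exp η, Real.add_one_le_exp (-η),
        mul_pos (Real.exp_pos η) (Real.exp_pos (-η)), sq_nonneg (Real.exp η - 1)]
    have hreal : Real.exp x ^ 2 + 1 ≤ (Real.exp η - 1) ^ 2 + 2 * Real.exp x := by nlinarith
    calc ENNReal.ofReal (Real.exp x) ^ 2 + 1 = ENNReal.ofReal (Real.exp x ^ 2 + 1) := by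
          rw [ENNReal.ofReal_add (by positivity) zero_le_one, ENNReal.ofReal_one,
            ENNReal.ofReal_pow (Real.exp_pos _).le]
      _ ≤ ENNReal.ofReal ((Real.exp η - 1) ^ 2 + 2 * Real.exp x) := ENNReal.ofReal_le_ofReal hreal
      _ = _ := by
          rw [ENNReal.ofReal_add (by positivity) (by positivity), ENNReal.ofReal_mul zero_le_two]
          simp
  have hint := lintegral_mono (μ := laplaceMeasure b) hpt
  rw [lintegral_add_right _ measurable_const, lintegral_add_left measurable_const,
    lintegral_const_mul _ (by fun_prop), hone] at hint
  simp only [lintegral_const, measure_univ, mul_one] at hint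
  rw [ENNReal.ofReal_add zero_le_one (by positivity), ENNReal.ofReal_one]
  refine (ENNReal.add_le_add_iff_right ENNReal.one_ne_top).1 (hint.trans_eq ?_)
  rw [← one_add_one_eq_two]
  ring

/-- Moving the shift from `g` to the density produces the likelihood ratio, and Cauchy–Schwarz
separates it from `g`. -/
theorem lintegral_laplace_shift_sq_le {r η d : ℝ} (hr : 0 < r) (hη : 0 < η) (hd : |d| ≤ r)
    {g : ℝ → ℝ≥0∞} (hg : Measurable g) :
    (∫⁻ z, g (z + d) ∂laplaceMeasure (r / η)) ^ 2 ≤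
      ENNReal.ofReal (1 + (Real.exp η - 1) ^ 2) * ∫⁻ z, g z ^ 2 ∂laplaceMeasure (r / η) := by
  have hb : 0 < r / η := div_pos hr hη
  have hshift : ∫⁻ z, g (z + d) ∂laplaceMeasure (r / η) =
      ∫⁻ z, ENNReal.ofReal (Real.exp ((|z| - |z - d|) / (r / η))) * g z
        ∂laplaceMeasure (r / η) := by
    rw [lintegral_laplaceMeasure _ (by fun_prop), lintegral_laplaceMeasure _ (by fun_prop),
      ← lintegral_sub_right_eq_self _ d]
    refine lintegral_congr fun z => ?_
    rw [sub_add_cancel, ← mul_assoc, ← ENNReal.ofReal_mul (by positivity), mul_assoc,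
      ← Real.exp_add]
    congr 4
    ring
  rw [hshift]
  refine (lintegral_mul_sq_le _ (by fun_prop) hg.aemeasurable).trans ?_
  gcongr
  exact lintegral_laplace_ratio_sq_le hr hη hd

/-! ### Histories of adaptively shifted noise -/

/-- The first `m` values of the process whose next value is the next noise, shifted by an amount
`d` that depends on the earlier values. -/
def shiftHistory (d : (m : ℕ) → (Fin m → ℝ) → ℝ) : (m : ℕ) → (Fin m → ℝ) → Fin m → ℝ
  | 0, _ => Fin.elim0
  | m + 1, N =>
      Fin.snoc (shiftHistory d m (Fin.init N))
        (d m (shiftHistory d m (Fin.init N)) + N (Fin.last m))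

theorem measurable_snoc {Ω : Type*} [MeasurableSpace Ω] {m : ℕ} {f : Ω → Fin m → ℝ} {g : Ω → ℝ}
    (hf : Measurable f) (hg : Measurable g) :
    Measurable fun ω => (Fin.snoc (f ω) (g ω) : Fin (m + 1) → ℝ) := by
  refine measurable_pi_iff.2 fun i => ?_
  refine Fin.lastCases ?_ (fun i => ?_) i
  · simpa using hg
  · simpa only [Fin.snoc_castSucc] using (measurable_pi_iff.1 hf) i

theorem measurable_init {m : ℕ} : Measurable (Fin.init : (Fin (m + 1) → ℝ) → Fin m → ℝ) :=
  measurable_pi_iff.2 fun _ => measurable_pi_apply _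

theorem measurable_shiftHistory {Ω : Type*} [MeasurableSpace Ω]
    {d : Ω → (m : ℕ) → (Fin m → ℝ) → ℝ}
    (hd : ∀ m, Measurable fun p : Ω × (Fin m → ℝ) => d p.1 m p.2) (m : ℕ) :
    Measurable fun p : Ω × (Fin m → ℝ) => shiftHistory (d p.1) m p.2 := by
  induction m with
  | zero => exact measurable_pi_iff.2 fun i => i.elim0
  | succ m ih =>
    have h : Measurable fun p : Ω × (Fin (m + 1) → ℝ) =>
        shiftHistory (d p.1) m (Fin.init p.2) :=
      ih.comp (measurable_fst.prodMk (measurable_init.comp measurable_snd))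
    exact measurable_snoc h (((hd m).comp (measurable_fst.prodMk h)).add
      ((measurable_pi_apply _).comp measurable_snd))

theorem lintegral_pi_succ (μ : Measure ℝ) [SigmaFinite μ] {m : ℕ} {f : (Fin (m + 1) → ℝ) → ℝ≥0∞}
    (hf : Measurable f) :
    ∫⁻ N, f N ∂Measure.pi (fun _ : Fin (m + 1) => μ) =
      ∫⁻ N, ∫⁻ z, f (Fin.snoc N z) ∂μ ∂Measure.pi (fun _ : Fin m => μ) := by
  have h := (measurePreserving_piFinSuccAbove (fun _ : Fin (m + 1) => μ) (Fin.last m)).symm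
  rw [← h.lintegral_comp hf]
  refine (lintegral_prod_symm _ (hf.comp (MeasurableEquiv.measurable _)).aemeasurable).trans ?_
  refine lintegral_congr fun N => lintegral_congr fun z => ?_
  exact congrArg f (Fin.insertNth_last' z N)

theorem shiftHistory_snoc (d : (m : ℕ) → (Fin m → ℝ) → ℝ) (m : ℕ) (N : Fin m → ℝ) (z : ℝ) :
    shiftHistory d (m + 1) (Fin.snoc N z) =
      Fin.snoc (shiftHistory d m N) (d m (shiftHistory d m N) + z) := by
  simp [shiftHistory]

/-- If the shifts `d` and `e` differ by at most `r`, the laws of the two histories under Laplace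
noise of scale `r / η` are close in the sense of the `χ²`-divergence. -/
theorem lintegral_shiftHistory_sq_le {Ω : Type*} [MeasurableSpace Ω] (π : Measure Ω)
    [IsProbabilityMeasure π] {r η : ℝ} (hr : 0 < r) (hη : 0 < η)
    {d e : Ω → (m : ℕ) → (Fin m → ℝ) → ℝ}
    (hd : ∀ m, Measurable fun p : Ω × (Fin m → ℝ) => d p.1 m p.2)
    (he : ∀ m, Measurable fun p : Ω × (Fin m → ℝ) => e p.1 m p.2)
    (hde : ∀ ω m w, |d ω m w - e ω m w| ≤ r) (m : ℕ) {F : Ω × (Fin m → ℝ) → ℝ≥0∞}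
    (hF : Measurable F) :
    (∫⁻ ω, ∫⁻ N, F (ω, shiftHistory (d ω) m N)
        ∂Measure.pi (fun _ : Fin m => laplaceMeasure (r / η)) ∂π) ^ 2 ≤
      ENNReal.ofReal (1 + (Real.exp η - 1) ^ 2) ^ m *
        ∫⁻ ω, ∫⁻ N, F (ω, shiftHistory (e ω) m N) ^ 2
          ∂Measure.pi (fun _ : Fin m => laplaceMeasure (r / η)) ∂π := by
  have := isProbabilityMeasure_laplaceMeasure (div_pos hr hη)
  set μ := laplaceMeasure (r / η)
  set V := ENNReal.ofReal (1 + (Real.exp η - 1) ^ 2)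
  induction m with
  | zero =>
    -- Both histories are empty, which leaves `(∫ F)² ≤ ∫ F²` over `π`.
    simp only [shiftHistory, lintegral_const, measure_univ, mul_one, pow_zero, one_mul]
    exact lintegral_sq_le π
      (hF.comp (measurable_id.prodMk measurable_const) : Measurable _).aemeasurable
  | succ m ih =>
    have hFd : ∀ ω, Measurable fun N => F (ω, shiftHistory (d ω) (m + 1) N) := fun ω =>
      hF.comp (measurable_const.prodMk
        ((measurable_shiftHistory hd (m + 1)).comp (measurable_const.prodMk measurable_id)))
    have hFe : ∀ ω, Measurable fun N => F (ω, shiftHistory (e ω) (m + 1) N) ^ 2 := fun ω =>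
      (hF.comp (measurable_const.prodMk ((measurable_shiftHistory he (m + 1)).comp
        (measurable_const.prodMk measurable_id)))).pow_const 2
    let I : Ω × (Fin m → ℝ) → ℝ≥0∞ := fun p =>
      V * ∫⁻ z, F (p.1, Fin.snoc p.2 (e p.1 m p.2 + z)) ^ 2 ∂μ
    have hI : Measurable I := by
      refine Measurable.const_mul (Measurable.lintegral_prod_right'
        (f := fun q : (Ω × (Fin m → ℝ)) × ℝ =>
          F (q.1.1, Fin.snoc q.1.2 (e q.1.1 m q.1.2 + q.2)) ^ 2) ?_) V
      refine (hF.comp (measurable_fst.fst.prodMk (measurable_snoc measurable_fst.snd ?_))).pow_const 2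
      exact ((he m).comp measurable_fst).add measurable_snd
    -- `G` bounds the last round under the shift `d` by a root mean square under `e`. The induction
    -- hypothesis applied to `G` then replaces `d` by `e` in the earlier rounds, and its square
    -- undoes the root.
    let G : Ω × (Fin m → ℝ) → ℝ≥0∞ := fun p => I p ^ (2 : ℝ)⁻¹
    have hG : Measurable G := hI.pow_const _
    have hG2 : ∀ p, G p ^ 2 = I p := fun p => by
      simp only [G]
      rw [← ENNReal.rpow_natCast, ← ENNReal.rpow_mul]; norm_num
    have hstep : ∀ ω (w : Fin m → ℝ),
        ∫⁻ z, F (ω, Fin.snoc w (d ω m w + z)) ∂μ ≤ G (ω, w) := fun ω w => by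
      have h := lintegral_laplace_shift_sq_le hr hη (hde ω m w)
        (g := fun u => F (ω, Fin.snoc w (e ω m w + u)))
        (hF.comp (measurable_const.prodMk
          (measurable_snoc measurable_const (measurable_const.add measurable_id))))
      have harg : ∀ z, e ω m w + (z + (d ω m w - e ω m w)) = d ω m w + z := fun z => by ring
      simp only [harg] at h
      rw [ENNReal.le_rpow_inv_iff two_pos, ENNReal.rpow_two]
      exact h
    calc (∫⁻ ω, ∫⁻ N, F (ω, shiftHistory (d ω) (m + 1) N)
          ∂Measure.pi (fun _ : Fin (m + 1) => μ) ∂π) ^ 2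
        ≤ (∫⁻ ω, ∫⁻ N, G (ω, shiftHistory (d ω) m N) ∂Measure.pi (fun _ : Fin m => μ) ∂π) ^ 2 := by
          gcongr with ω
          rw [lintegral_pi_succ μ (hFd ω)]
          gcongr with N
          simp only [shiftHistory_snoc]
          exact hstep _ _
      _ ≤ V ^ m * ∫⁻ ω, ∫⁻ N, G (ω, shiftHistory (e ω) m N) ^ 2
            ∂Measure.pi (fun _ : Fin m => μ) ∂π := ih hG
      _ = V ^ m * (V * ∫⁻ ω, ∫⁻ N, F (ω, shiftHistory (e ω) (m + 1) N) ^ 2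
            ∂Measure.pi (fun _ : Fin (m + 1) => μ) ∂π) := by
          have hVt : V ≠ ∞ := ENNReal.ofReal_ne_top
          congr 1
          rw [← lintegral_const_mul' _ _ hVt]
          refine lintegral_congr fun ω => ?_
          rw [lintegral_pi_succ μ (hFe ω), ← lintegral_const_mul' _ _ hVt]
          refine lintegral_congr fun N => ?_
          rw [hG2]
          simp only [I, shiftHistory_snoc]
      _ = _ := by rw [pow_succ, mul_assoc]

theorem take_snoc {j m : ℕ} (h : j ≤ m) (w : Fin m → ℝ) (z : ℝ) :
    (Fin.take j (h.trans m.le_succ) (Fin.snoc w z : Fin (m + 1) → ℝ) : Fin j → ℝ) =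
      Fin.take j h w := by
  funext i
  exact Fin.snoc_castSucc (α := fun _ => ℝ) z w (Fin.castLE h i)

theorem take_shiftHistory (d : (m : ℕ) → (Fin m → ℝ) → ℝ) {j m : ℕ} (h : j ≤ m)
    (N : Fin m → ℝ) :
    (Fin.take j h (shiftHistory d m N) : Fin j → ℝ) = shiftHistory d j (Fin.take j h N) := by
  induction m with
  | zero =>
    obtain rfl : j = 0 := by omega
    rfl
  | succ m ih =>
    rcases Nat.of_le_succ h with h' | rfl
    · exact (take_snoc h' _ _).trans (ih h' (Fin.init N))
    · rfl

/-- Agreement is required only along the trajectory of `d`, so absence of deviation on the clamped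
history alone suffices to identify it with the real one. -/
theorem shiftHistory_congr {d e : (m : ℕ) → (Fin m → ℝ) → ℝ} {m : ℕ} {N : Fin m → ℝ}
    (h : ∀ (j : ℕ) (hj : j < m), d j (Fin.take j hj.le (shiftHistory d m N)) =
      e j (Fin.take j hj.le (shiftHistory d m N))) :
    shiftHistory d m N = shiftHistory e m N := by
  induction m with
  | zero => rfl
  | succ m ih =>
    have hprev : shiftHistory d m (Fin.init N) = shiftHistory e m (Fin.init N) := by
      refine ih fun j hj => ?_
      have := h j (hj.trans m.lt_succ_self)
      rwa [shiftHistory, take_snoc hj.le] at this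
    have hlast := h m m.lt_succ_self
    rw [shiftHistory, take_snoc le_rfl, Fin.take_eq_self] at hlast
    rw [shiftHistory, shiftHistory, hlast, hprev]

/-! ### The clamped interaction -/

namespace Analyst

variable {n : ℕ} {𝒳 : Type u} [MeasurableSpace 𝒳] {P : Measure (Dataset n 𝒳)} {γ : ℝ → ℝ}
  {k : ℕ} {S : Type v} [MeasurableSpace S]

/-- The value on the dataset of the query asked after the answers `w`. -/
noncomputable def sampleValue (A : Analyst P γ k S) (ω : Dataset n 𝒳 × S) (m : ℕ)
    (w : Fin m → ℝ) : ℝ :=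
  -- `shiftHistory` takes shifts for all `m`; those with `m ≥ k` never enter a history of length
  -- `k`.
  if h : m < k then A.query ⟨m, h⟩ ω.2 w ω.1 else 0

/-- The expected value of the query asked after the answers `w`. -/
noncomputable def populationValue (A : Analyst P γ k S) (ω : Dataset n 𝒳 × S) (m : ℕ)
    (w : Fin m → ℝ) : ℝ :=
  if h : m < k then ∫ y, A.query ⟨m, h⟩ ω.2 w y ∂P else 0

/-- The value on the dataset, replaced by the nearest number that is within `r` of the expected
value. -/
noncomputable def clampedValue (A : Analyst P γ k S) (r : ℝ) (ω : Dataset n 𝒳 × S) (m : ℕ)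
    (w : Fin m → ℝ) : ℝ :=
  A.populationValue ω m w + max (-r) (min r (A.sampleValue ω m w - A.populationValue ω m w))

/-- The pairs of a state of dataset and coins and of a list of answers such that in some round the
query deviates by more than `r` on the dataset. -/
def deviationSet (A : Analyst P γ k S) (r : ℝ) : Set ((Dataset n 𝒳 × S) × (Fin k → ℝ)) :=
  {p | ∃ j : Fin k, r < |A.sampleValue p.1 j (Fin.take j j.isLt.le p.2) -
    A.populationValue p.1 j (Fin.take j j.isLt.le p.2)|}

theorem measurable_sampleValue (A : Analyst P γ k S) (m : ℕ) :
    Measurable fun p : (Dataset n 𝒳 × S) × (Fin m → ℝ) => A.sampleValue p.1 m p.2 := by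
  unfold sampleValue
  split_ifs with h
  · exact (A.measurable_query ⟨m, h⟩).comp
      (measurable_fst.snd.prodMk (measurable_snd.prodMk measurable_fst.fst))
  · exact measurable_const

theorem measurable_populationValue [SFinite P] (A : Analyst P γ k S) (m : ℕ) :
    Measurable fun p : (Dataset n 𝒳 × S) × (Fin m → ℝ) => A.populationValue p.1 m p.2 := by
  unfold populationValue
  split_ifs with h
  · have hq : Measurable fun q : ((Dataset n 𝒳 × S) × (Fin m → ℝ)) × Dataset n 𝒳 =>
        A.query ⟨m, h⟩ q.1.1.2 q.1.2 q.2 :=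
      (A.measurable_query ⟨m, h⟩).comp
        (measurable_fst.fst.snd.prodMk (measurable_fst.snd.prodMk measurable_snd))
    exact (hq.stronglyMeasurable.integral_prod_right (ν := P)).measurable
  · exact measurable_const

theorem measurable_clampedValue [SFinite P] (A : Analyst P γ k S) (r : ℝ) (m : ℕ) :
    Measurable fun p : (Dataset n 𝒳 × S) × (Fin m → ℝ) => A.clampedValue r p.1 m p.2 :=
  (A.measurable_populationValue m).add (measurable_const.max (measurable_const.min
    ((A.measurable_sampleValue m).sub (A.measurable_populationValue m))))

theorem measurableSet_deviationSet [SFinite P] (A : Analyst P γ k S) (r : ℝ) :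
    MeasurableSet (A.deviationSet r) := by
  unfold deviationSet
  rw [Set.ofPred_exists]
  refine MeasurableSet.iUnion fun j => measurableSet_lt measurable_const ?_
  have htake : Measurable fun p : (Dataset n 𝒳 × S) × (Fin k → ℝ) =>
      (p.1, (Fin.take j j.isLt.le p.2 : Fin j → ℝ)) :=
    measurable_fst.prodMk (measurable_pi_iff.2 fun i =>
      (measurable_pi_apply (Fin.castLE j.isLt.le i)).comp measurable_snd)
  exact continuous_abs.measurable.comp (((A.measurable_sampleValue j).comp htake).sub
    ((A.measurable_populationValue j).comp htake))

theorem abs_clampedValue_sub_le (A : Analyst P γ k S) {r : ℝ} (hr : 0 ≤ r)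
    (ω : Dataset n 𝒳 × S) (m : ℕ) (w : Fin m → ℝ) :
    |A.clampedValue r ω m w - A.populationValue ω m w| ≤ r := by
  rw [clampedValue, add_sub_cancel_left, abs_le]
  exact ⟨le_max_left _ _, max_le (by linarith) (min_le_left _ _)⟩

theorem clampedValue_eq (A : Analyst P γ k S) {r : ℝ} {ω : Dataset n 𝒳 × S} {m : ℕ}
    {w : Fin m → ℝ} (h : |A.sampleValue ω m w - A.populationValue ω m w| ≤ r) :
    A.clampedValue r ω m w = A.sampleValue ω m w := by
  rw [clampedValue, min_eq_right (abs_le.1 h).2, max_eq_right (abs_le.1 h).1, add_sub_cancel]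

theorem history_eq_shiftHistory (A : Analyst P γ k S) (x : Dataset n 𝒳) (s : S) (N : Fin k → ℝ)
    (m : ℕ) (h : m ≤ k) :
    A.history x s N m h = shiftHistory (A.sampleValue (x, s)) m (Fin.take m h N) := by
  induction m with
  | zero => rfl
  | succ m ih =>
    have hinit : (Fin.init (Fin.take (m + 1) h N) : Fin m → ℝ) =
        Fin.take m (Nat.le_of_succ_le h) N := rfl
    rw [history, shiftHistory, hinit, ← ih (Nat.le_of_succ_le h)]
    simp only [laplaceAnswer, sampleValue, Nat.lt_of_succ_le h, dite_true]
    rfl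

theorem le_worstTrueError_subset (A : Analyst P γ k S) (hk : 1 ≤ k) {α r : ℝ} (hrα : r < α / 2) :
    {ω : Dataset n 𝒳 × S × (Fin k → ℝ) | α ≤ A.worstTrueError ω.1 ω.2.1 ω.2.2} ⊆
      {ω | ∃ j, α / 2 ≤ |ω.2.2 j|} ∪
        {ω | ((ω.1, ω.2.1), shiftHistory (A.clampedValue r (ω.1, ω.2.1)) k ω.2.2) ∈
          A.deviationSet r} := by
  rintro ⟨x, s, N⟩ hω
  by_contra hcon
  simp only [Set.mem_union, Set.mem_ofPred_eq, deviationSet, not_or, not_exists, not_le,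
    not_lt] at hcon hω
  obtain ⟨hN, hdev⟩ := hcon
  have hH : shiftHistory (A.clampedValue r (x, s)) k N =
      shiftHistory (A.sampleValue (x, s)) k N :=
    shiftHistory_congr fun j hj => A.clampedValue_eq (hdev ⟨j, hj⟩)
  have : Nonempty (Fin k) := ⟨⟨0, hk⟩⟩
  obtain ⟨j, hj⟩ := exists_eq_ciSup_of_finite
    (f := fun j : Fin k => |(∫ y, A.chosenQuery x s N j y ∂P) - A.answer x s N j|)
  have hj' : α ≤ |(∫ y, A.chosenQuery x s N j y ∂P) - A.answer x s N j| := hω.trans_eq hj.symm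
  have hd := hdev j
  rw [hH, take_shiftHistory, ← history_eq_shiftHistory] at hd
  simp only [sampleValue, populationValue, j.isLt, dite_true] at hd
  have hrw : (∫ y, A.chosenQuery x s N j y ∂P) - A.answer x s N j =
      -((A.query j s (A.history x s N j j.isLt.le) x -
        ∫ y, A.query j s (A.history x s N j j.isLt.le) y ∂P) + N j) := by
    simp only [chosenQuery, answer, laplaceAnswer]
    ring
  rw [hrw, abs_neg] at hj'
  have := hj'.trans (abs_add_le _ _)
  have := hN j
  have : |A.query j s (A.history x s N j j.isLt.le) x -
        ∫ y, A.query j s (A.history x s N j j.isLt.le) y ∂P| ≤ r := hd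
  linarith

end Analyst

/-! ### Noise and deviation probabilities of the interaction -/

theorem lintegral_interactionMeasure {n : ℕ} {𝒳 : Type u} [MeasurableSpace 𝒳]
    (P : Measure (Dataset n 𝒳)) [IsProbabilityMeasure P] {S : Type v} [MeasurableSpace S]
    (ρ : Measure S) [IsProbabilityMeasure ρ] (k : ℕ) {b : ℝ} (hb : 0 < b)
    {F : (Dataset n 𝒳 × S) × (Fin k → ℝ) → ℝ≥0∞} (hF : Measurable F) :
    ∫⁻ ω, F ((ω.1, ω.2.1), ω.2.2) ∂interactionMeasure P ρ k b =
      ∫⁻ p, ∫⁻ N, F (p, N) ∂Measure.pi (fun _ : Fin k => laplaceMeasure b) ∂P.prod ρ := by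
  have := isProbabilityMeasure_laplaceMeasure hb
  have hmp := measurePreserving_prodAssoc P ρ (Measure.pi fun _ : Fin k => laplaceMeasure b)
  rw [← lintegral_prod _ hF.aemeasurable, interactionMeasure, ← hmp.lintegral_comp (by fun_prop)]
  rfl

theorem interactionMeasure_noise_le {n : ℕ} {𝒳 : Type u} [MeasurableSpace 𝒳]
    (P : Measure (Dataset n 𝒳)) [IsProbabilityMeasure P] {S : Type v} [MeasurableSpace S]
    (ρ : Measure S) [IsProbabilityMeasure ρ] (k : ℕ) {b : ℝ} (hb : 0 < b) (t : ℝ) :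
    interactionMeasure P ρ k b {ω | ∃ j, t ≤ |ω.2.2 j|} ≤
      k * ENNReal.ofReal (2 * Real.exp (-t / (2 * b))) := by
  have := isProbabilityMeasure_laplaceMeasure hb
  rw [Set.ofPred_exists]
  refine (measure_iUnion_le _).trans ?_
  rw [tsum_fintype]
  refine (Finset.sum_le_card_nsmul _ _ (ENNReal.ofReal (2 * Real.exp (-t / (2 * b))))
    fun j _ => ?_).trans_eq (by simp)
  have hset : MeasurableSet {z : ℝ | t ≤ |z|} := measurableSet_le measurable_const (by fun_prop)
  have hmp : MeasurePreserving (fun ω : Dataset n 𝒳 × S × (Fin k → ℝ) => ω.2.2 j)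
      (interactionMeasure P ρ k b) (laplaceMeasure b) :=
    (measurePreserving_eval (fun _ : Fin k => laplaceMeasure b) j).comp
      (measurePreserving_snd.comp measurePreserving_snd)
  exact (hmp.measure_preimage hset.nullMeasurableSet).trans_le (laplaceMeasure_abs_ge_le hb t)

theorem measure_deviation_le {n : ℕ} {𝒳 : Type u} [MeasurableSpace 𝒳]
    {P : Measure (Dataset n 𝒳)} [IsProbabilityMeasure P] {γ : ℝ → ℝ} {ν r : ℝ} (hν : 0 < ν)
    (hr : IsAdmissibleWidth γ ν r) {q : Dataset n 𝒳 → ℝ} (hq : q ∈ concentratedQueries P γ) :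
    P {x | r < |q x - ∫ y, q y ∂P|} ≤ ENNReal.ofReal ν := by
  rw [← ofReal_measureReal]
  refine ENNReal.ofReal_le_ofReal ((hq.2.2 r hr.1).le.trans ?_)
  have h := hr.2
  rw [one_div, Real.log_inv] at h
  rw [← Real.exp_log hν]
  exact Real.exp_le_exp.2 (by linarith)

/-- When the answers do not depend on the dataset, the queries rarely deviate on it. -/
theorem lintegral_deviation_independent_le {n : ℕ} {𝒳 : Type u} [MeasurableSpace 𝒳]
    {P : Measure (Dataset n 𝒳)} [IsProbabilityMeasure P] {S : Type v} [MeasurableSpace S]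
    (ρ : Measure S) [IsProbabilityMeasure ρ] {γ : ℝ → ℝ} {k : ℕ} {b : ℝ} (hb : 0 < b) {ν r : ℝ}
    (hν : 0 < ν) (hr : IsAdmissibleWidth γ ν r) (A : Analyst P γ k S) :
    ∫⁻ p, ∫⁻ N, (A.deviationSet r).indicator 1 (p, shiftHistory (A.populationValue p) k N)
        ∂Measure.pi (fun _ : Fin k => laplaceMeasure b) ∂P.prod ρ ≤
      k * ENNReal.ofReal ν := by
  have := isProbabilityMeasure_laplaceMeasure hb
  have hmeas : Measurable fun q : (Dataset n 𝒳 × S) × (Fin k → ℝ) =>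
      (A.deviationSet r).indicator (1 : (Dataset n 𝒳 × S) × (Fin k → ℝ) → ℝ≥0∞)
        (q.1, shiftHistory (A.populationValue q.1) k q.2) :=
    (measurable_one.indicator (A.measurableSet_deviationSet r)).comp (measurable_fst.prodMk
      (measurable_shiftHistory A.measurable_populationValue k))
  rw [← lintegral_interactionMeasure P ρ k hb hmeas, interactionMeasure]
  -- Fubini: the dataset is integrated first, with coins and noise frozen.
  refine (lintegral_prod_symm _ (hmeas.comp ((measurable_fst.prodMk measurable_snd.fst).prodMk
    measurable_snd.snd)).aemeasurable).trans_le ?_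
  have hle : ∀ t : S × (Fin k → ℝ),
      ∫⁻ x, (A.deviationSet r).indicator (1 : (Dataset n 𝒳 × S) × (Fin k → ℝ) → ℝ≥0∞)
        ((x, t.1), shiftHistory (A.populationValue (x, t.1)) k t.2) ∂P ≤
      k * ENNReal.ofReal ν := by
    rintro ⟨s, N⟩
    -- `populationValue` ignores the dataset, so the history computed from any `x₀` is the history
    -- for every `x`, and the queries are fixed.
    obtain ⟨x₀⟩ : Nonempty (Dataset n 𝒳) := P.nonempty_of_neZero
    set w := shiftHistory (A.populationValue (x₀, s)) k N with hw
    have hset : MeasurableSet {x | ((x, s), w) ∈ A.deviationSet r} :=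
      measurable_prodMk_right.prodMk measurable_const (A.measurableSet_deviationSet r)
    calc _ = P {x | ((x, s), w) ∈ A.deviationSet r} := (lintegral_indicator_one hset)
      _ = P (⋃ j : Fin k, {x | r < |A.query j s (Fin.take j j.isLt.le w) x -
            ∫ y, A.query j s (Fin.take j j.isLt.le w) y ∂P|}) := by
          congr 1
          ext x
          simp [Analyst.deviationSet, Analyst.sampleValue, Analyst.populationValue]
      _ ≤ ∑ j : Fin k, P {x | r < |A.query j s (Fin.take j j.isLt.le w) x -
            ∫ y, A.query j s (Fin.take j j.isLt.le w) y ∂P|} :=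
          (measure_iUnion_le _).trans_eq (tsum_fintype _)
      _ ≤ ∑ _j : Fin k, ENNReal.ofReal ν :=
          Finset.sum_le_sum fun j _ => measure_deviation_le hν hr (A.query_mem _ _ _)
      _ = k * ENNReal.ofReal ν := by simp
  exact (lintegral_mono hle).trans_eq (by simp)

theorem interactionMeasure_deviation_sq_le {n : ℕ} {𝒳 : Type u} [MeasurableSpace 𝒳]
    {P : Measure (Dataset n 𝒳)} [IsProbabilityMeasure P] {S : Type v} [MeasurableSpace S]
    (ρ : Measure S) [IsProbabilityMeasure ρ] {γ : ℝ → ℝ} {k : ℕ} {η ν r : ℝ} (hη : 0 < η)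
    (hν : 0 < ν) (hr : IsAdmissibleWidth γ ν r) (A : Analyst P γ k S) :
    interactionMeasure P ρ k (r / η)
        {ω | ((ω.1, ω.2.1), shiftHistory (A.clampedValue r (ω.1, ω.2.1)) k ω.2.2) ∈
          A.deviationSet r} ^ 2 ≤
      ENNReal.ofReal (1 + (Real.exp η - 1) ^ 2) ^ k * (k * ENNReal.ofReal ν) := by
  have hb : 0 < r / η := div_pos hr.1 hη
  have hF : Measurable ((A.deviationSet r).indicator (1 : (Dataset n 𝒳 × S) × (Fin k → ℝ) → ℝ≥0∞)) :=
    measurable_one.indicator (A.measurableSet_deviationSet r)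
  have hpair : Measurable fun q : (Dataset n 𝒳 × S) × (Fin k → ℝ) =>
      (q.1, shiftHistory (A.clampedValue r q.1) k q.2) :=
    measurable_fst.prodMk (measurable_shiftHistory (A.measurable_clampedValue r) k)
  have hset : MeasurableSet {ω : Dataset n 𝒳 × S × (Fin k → ℝ) |
      ((ω.1, ω.2.1), shiftHistory (A.clampedValue r (ω.1, ω.2.1)) k ω.2.2) ∈
        A.deviationSet r} :=
    (hpair.comp ((measurable_fst.prodMk measurable_snd.fst).prodMk measurable_snd.snd))
      (A.measurableSet_deviationSet r)
  rw [← lintegral_indicator_one hset]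
  have h := lintegral_shiftHistory_sq_le (P.prod ρ) hr.1 hη (A.measurable_clampedValue r)
    A.measurable_populationValue (A.abs_clampedValue_sub_le hr.1.le) k hF
  -- An indicator is its own square, so the second moment is again a probability.
  have hsq : ∀ p, (A.deviationSet r).indicator (1 : (Dataset n 𝒳 × S) × (Fin k → ℝ) → ℝ≥0∞) p ^ 2 =
      (A.deviationSet r).indicator 1 p := fun p => by
    by_cases hp : p ∈ A.deviationSet r <;> simp [hp]
  simp only [hsq] at h
  have hlift := lintegral_interactionMeasure P ρ k hb (hF.comp hpair)
  simp only [Function.comp_apply] at hlift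
  rw [← hlift] at h
  refine h.trans ?_
  gcongr
  exact lintegral_deviation_independent_le ρ hb hν hr A

/-! ### The choice of the parameters -/

theorem two_lt_log_div {β : ℝ} (hβ : 0 < β) (hβ2 : β < Real.exp (-2)) {k : ℕ} (hk : 1 ≤ k) :
    2 < Real.log (k / β) := by
  have hk' : (1 : ℝ) ≤ k := by exact_mod_cast hk
  rw [Real.lt_log_iff_exp_lt (by positivity), lt_div_iff₀ hβ]
  calc Real.exp 2 * β < Real.exp 2 * Real.exp (-2) := by gcongr
    _ = 1 := by rw [← Real.exp_add]; simp
    _ ≤ k := hk'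

theorem scaledAccuracy_lt_half {α β : ℝ} {k : ℕ} (hk : 1 ≤ k) (hα : 0 < α)
    (hL : 2 < Real.log (k / β)) : scaledAccuracy α β k < α / 2 := by
  have hk' : 1 ≤ Real.sqrt k := Real.one_le_sqrt.2 (by exact_mod_cast hk)
  have h : Real.log (k / β) ^ (1 : ℝ) ≤ Real.log (k / β) ^ (3 / 2 : ℝ) :=
    Real.rpow_le_rpow_of_exponent_le (by linarith) (by norm_num)
  rw [Real.rpow_one] at h
  unfold scaledAccuracy
  gcongr
  nlinarith

/-- The exponent is `αη/(4r)`. The bounds on `η` and `r` make it at least `L = ln(k/β)`; this fixes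
`c₀ = 4` and the power `3/2` in `scaledAccuracy`. -/
theorem exp_noise_le {α β η r : ℝ} {k : ℕ} (hk : 1 ≤ k) (hα : 0 < α) (hβ : 0 < β)
    (hL : 2 < Real.log (k / β)) (hη : 4 / Real.sqrt (k * Real.log (k / β)) ≤ η) (hr : 0 < r)
    (hra : r ≤ scaledAccuracy α β k) :
    Real.exp (-(α / 2) / (2 * (r / η))) ≤ β / k := by
  have hk' : (0 : ℝ) < k := by exact_mod_cast hk
  set L := Real.log (k / β) with hLdef
  have hL0 : 0 < L := by linarith
  have hη0 : 0 < η := lt_of_lt_of_le (by positivity) hη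
  have hpow : L ^ (3 / 2 : ℝ) = L * Real.sqrt L := by
    rw [show (3 / 2 : ℝ) = 1 + 1 / 2 by norm_num, Real.rpow_add hL0, Real.rpow_one,
      Real.sqrt_eq_rpow]
  have hβk : β / k = Real.exp (-L) := by
    rw [Real.exp_neg, hLdef, Real.exp_log (by positivity), inv_div]
  rw [hβk, Real.exp_le_exp, neg_div, neg_le_neg_iff, le_div_iff₀ (by positivity)]
  have h1 : L * (4 * r) ≤ α * η :=
    calc L * (4 * r) ≤ L * (4 * scaledAccuracy α β k) := by gcongr
      _ = α * (4 / Real.sqrt (k * L)) := by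
          rw [scaledAccuracy, ← hLdef, hpow, Real.sqrt_mul hk'.le]
          have := Real.sqrt_pos.2 hk'
          have := Real.sqrt_pos.2 hL0
          field_simp
      _ ≤ α * η := by gcongr
  have h2 : L * (2 * (r / η)) = L * (4 * r) / η / 2 := by field_simp; ring
  rw [h2]
  gcongr
  rwa [div_le_iff₀ hη0]

/-- Here `kη² ≤ c₁²`, `η ≤ c₁` and `e^η - 1 ≤ η e^η`, so the cost of `k` rounds does not grow with
`k`. -/
theorem one_add_sq_pow_le {c₁ η L : ℝ} {k : ℕ} (hk : 1 ≤ k) (hL : 1 ≤ L) (hη : 0 ≤ η)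
    (hηc : η ≤ c₁ / Real.sqrt (k * L)) :
    (1 + (Real.exp η - 1) ^ 2) ^ k ≤ Real.exp (c₁ ^ 2 * Real.exp c₁ ^ 2) := by
  have hk' : (1 : ℝ) ≤ k := by exact_mod_cast hk
  have hkL : (k : ℝ) ≤ k * L := le_mul_of_one_le_right (by linarith) hL
  have hs : 0 < Real.sqrt (k * L) := Real.sqrt_pos.2 (by linarith)
  have hmul : η * Real.sqrt (k * L) ≤ c₁ := (le_div_iff₀ hs).1 hηc
  have hs1 : 1 ≤ Real.sqrt (k * L) := Real.one_le_sqrt.2 (hk'.trans hkL)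
  have hηc₁ : η ≤ c₁ := (le_mul_of_one_le_right hη hs1).trans hmul
  have hkη : k * η ^ 2 ≤ c₁ ^ 2 :=
    calc k * η ^ 2 ≤ (k * L) * η ^ 2 := by gcongr
      _ = (η * Real.sqrt (k * L)) ^ 2 := by
          rw [mul_pow, Real.sq_sqrt (by linarith)]; ring
      _ ≤ c₁ ^ 2 := by gcongr
  have hexp : Real.exp η - 1 ≤ η * Real.exp η := by
    have h1 := mul_le_mul_of_nonneg_left (Real.add_one_le_exp (-η)) (Real.exp_pos η).le
    rw [← Real.exp_add, add_neg_cancel, Real.exp_zero] at h1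
    linarith
  have hexp0 : 0 ≤ Real.exp η - 1 := sub_nonneg.2 (Real.one_le_exp hη)
  calc (1 + (Real.exp η - 1) ^ 2) ^ k ≤ Real.exp ((Real.exp η - 1) ^ 2) ^ k := by
        gcongr
        linarith [Real.add_one_le_exp ((Real.exp η - 1) ^ 2)]
    _ = Real.exp (k * (Real.exp η - 1) ^ 2) := (Real.exp_nat_mul _ _).symm
    _ ≤ Real.exp (c₁ ^ 2 * Real.exp c₁ ^ 2) := by
        refine Real.exp_le_exp.2 ?_
        calc k * (Real.exp η - 1) ^ 2 ≤ k * (η * Real.exp η) ^ 2 := by gcongr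
          _ = (k * η ^ 2) * Real.exp η ^ 2 := by ring
          _ ≤ c₁ ^ 2 * Real.exp c₁ ^ 2 := by gcongr

/-! ### Assembling the bound -/

theorem isProbabilityMeasure_interactionMeasure {n : ℕ} {𝒳 : Type u} [MeasurableSpace 𝒳]
    (P : Measure (Dataset n 𝒳)) [IsProbabilityMeasure P] {S : Type v} [MeasurableSpace S]
    (ρ : Measure S) [IsProbabilityMeasure ρ] (k : ℕ) {b : ℝ} (hb : 0 < b) :
    IsProbabilityMeasure (interactionMeasure P ρ k b) := by
  have := isProbabilityMeasure_laplaceMeasure hb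
  unfold interactionMeasure
  infer_instance

theorem measureReal_worstTrueError_le {n : ℕ} {𝒳 : Type u} [MeasurableSpace 𝒳]
    {P : Measure (Dataset n 𝒳)} [IsProbabilityMeasure P] {S : Type v} [MeasurableSpace S]
    (ρ : Measure S) [IsProbabilityMeasure ρ] {γ : ℝ → ℝ} {k : ℕ} (hk : 1 ≤ k) {α η ν r : ℝ}
    (hη : 0 < η) (hν : 0 < ν) (hr : IsAdmissibleWidth γ ν r) (hrα : r < α / 2)
    (A : Analyst P γ k S) :
    (interactionMeasure P ρ k (r / η)).real {ω | α ≤ A.worstTrueError ω.1 ω.2.1 ω.2.2} ≤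
      k * (2 * Real.exp (-(α / 2) / (2 * (r / η)))) +
        Real.sqrt ((1 + (Real.exp η - 1) ^ 2) ^ k * (k * ν)) := by
  have hb : 0 < r / η := div_pos hr.1 hη
  have := isProbabilityMeasure_interactionMeasure P ρ k hb
  refine (measureReal_mono (A.le_worstTrueError_subset hk hrα)).trans
    ((measureReal_union_le _ _).trans (add_le_add ?_ (Real.le_sqrt_of_sq_le ?_)))
  · refine ENNReal.toReal_le_of_le_ofReal (by positivity)
      ((interactionMeasure_noise_le P ρ k hb (α / 2)).trans_eq ?_)
    rw [ENNReal.ofReal_mul (Nat.cast_nonneg k), ENNReal.ofReal_natCast]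
  · rw [measureReal_def, ← ENNReal.toReal_pow]
    refine ENNReal.toReal_le_of_le_ofReal (by positivity)
      ((interactionMeasure_deviation_sq_le ρ hη hν hr A).trans_eq ?_)
    rw [ENNReal.ofReal_mul (by positivity), ENNReal.ofReal_mul (Nat.cast_nonneg k),
      ENNReal.ofReal_natCast, ENNReal.ofReal_pow (by positivity)]

end TypicalStability

open TypicalStability in
theorem mainTheorem4 :
    ∃ c₀ : ℝ, 0 < c₀ ∧ ∀ c₁ : ℝ, c₀ ≤ c₁ → ∀ K : ℝ, 1 ≤ K →
    ∃ C : ℝ, 0 < C ∧ ∃ c : ℝ, 0 < c ∧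
    ∀ (𝒳 : Type u) [MeasurableSpace 𝒳] (n : ℕ)
      (P : Measure (Dataset n 𝒳)) [IsProbabilityMeasure P]
      (γ : ℝ → ℝ) (_hγ_nonneg : ∀ t : ℝ, 0 < t → 0 ≤ γ t) (_hγ_mono : MonotoneOn γ (Set.Ioi 0))
      (k : ℕ) (_hk : 1 ≤ k) (α β : ℝ) (_hα : 0 < α) (_hβ_pos : 0 < β) (_hβ_lt : β < 1)
      (η ν : ℝ)
      (_hη_lower : c₀ / Real.sqrt (k * Real.log (k / β)) ≤ η)
      (_hη_upper : η ≤ c₁ / Real.sqrt (k * Real.log (k / β)))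
      (_hν_pos : 0 < ν) (_hν_upper : ν ≤ K * Real.exp (-γ (scaledAccuracy α β k)))
      (r : ℝ) (_hr : IsAdmissibleWidth γ ν r) (_hr_le : r ≤ scaledAccuracy α β k)
      (S : Type v) [MeasurableSpace S] (ρ : Measure S) [IsProbabilityMeasure ρ]
      (A : Analyst P γ k S),
      (interactionMeasure P ρ k (r / η)).real
          {ω | α ≤ A.worstTrueError ω.1 ω.2.1 ω.2.2} ≤
        C * ((k : ℝ) ^ (3 / 4 : ℝ) * Real.log (k / β) ^ (1 / 4 : ℝ) *
          Real.exp (-(c * γ (scaledAccuracy α β k))) + β) := by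
  refine ⟨4, by norm_num, fun c₁ hc₁ K hK => ?_⟩
  set M := Real.exp (c₁ ^ 2 * Real.exp c₁ ^ 2) with hM
  have hM1 : 1 ≤ M := Real.one_le_exp (by positivity)
  -- `e²` serves both the noise and the trivial range of `β`; `M K` serves the deviations. The
  -- exponent `1/2` comes from the square root in Cauchy–Schwarz.
  refine ⟨Real.exp 2 + M * K, by positivity, 1 / 2, by norm_num, ?_⟩
  intro 𝒳 _ n P _ γ _ _ k hk α β hα hβ hβ1 η ν hη_lower hη_upper hν hν_upper r hr hr_le S _ ρ _ A
  have hk' : (1 : ℝ) ≤ k := by exact_mod_cast hk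
  have hkβ : 1 < k / β := by rw [lt_div_iff₀ hβ]; linarith
  have hL0 : 0 < Real.log (k / β) := Real.log_pos hkβ
  have hη : 0 < η := lt_of_lt_of_le (by positivity) hη_lower
  -- For `β ≥ e^{-2}` the right side is at least `1`. Otherwise `ln(k/β) > 2`, which ensures `r <
  -- α/2`.
  rcases le_or_gt (Real.exp (-2)) β with hβ2 | hβ2
  · have := isProbabilityMeasure_interactionMeasure P ρ k (div_pos hr.1 hη)
    calc (interactionMeasure P ρ k (r / η)).real {ω | α ≤ A.worstTrueError ω.1 ω.2.1 ω.2.2}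
        ≤ 1 := measureReal_le_one
      _ = Real.exp 2 * Real.exp (-2) := by rw [← Real.exp_add]; simp
      _ ≤ (Real.exp 2 + M * K) * (0 + β) := by
          rw [zero_add]
          gcongr
          exact le_add_of_nonneg_right (by positivity)
      _ ≤ _ := by gcongr; positivity
  have hL := two_lt_log_div hβ hβ2 hk
  refine (measureReal_worstTrueError_le ρ hk hη hν hr
    (hr_le.trans_lt (scaledAccuracy_lt_half hk hα hL)) A).trans ?_
  have hnoise : k * (2 * Real.exp (-(α / 2) / (2 * (r / η)))) ≤ Real.exp 2 * β :=
    calc k * (2 * Real.exp (-(α / 2) / (2 * (r / η)))) ≤ k * (2 * (β / k)) := by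
          gcongr
          exact exp_noise_le hk hα hβ hL hη_lower hr.1 hr_le
      _ = 2 * β := by field_simp
      _ ≤ Real.exp 2 * β := by
          gcongr
          linarith [Real.add_one_le_exp (2 : ℝ)]
  set g := γ (scaledAccuracy α β k)
  set T := (k : ℝ) ^ (3 / 4 : ℝ) * Real.log (k / β) ^ (1 / 4 : ℝ) * Real.exp (-(1 / 2 * g))
  have hT : k * Real.exp (-g) ≤ T ^ 2 := by
    have h1 : (1 : ℝ) ≤ Real.log (k / β) ^ (1 / 4 : ℝ) :=
      Real.one_le_rpow (by linarith) (by norm_num)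
    have h2 : (k : ℝ) ≤ ((k : ℝ) ^ (3 / 4 : ℝ)) ^ 2 := by
      rw [← Real.rpow_natCast, ← Real.rpow_mul (by linarith)]
      exact Real.self_le_rpow_of_one_le hk' (by norm_num)
    have h3 : Real.exp (-g) = Real.exp (-(1 / 2 * g)) ^ 2 := by
      rw [← Real.exp_nat_mul]; congr 1; push_cast; ring
    rw [mul_pow, mul_pow, h3]
    gcongr
    exact h2.trans (le_mul_of_one_le_right (by positivity) (one_le_pow₀ h1))
  have hT0 : 0 ≤ T := by positivity
  have hdev : Real.sqrt ((1 + (Real.exp η - 1) ^ 2) ^ k * (k * ν)) ≤ M * K * T := by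
    refine Real.sqrt_le_iff.2 ⟨by positivity, ?_⟩
    calc (1 + (Real.exp η - 1) ^ 2) ^ k * (k * ν) ≤ M * (k * (K * Real.exp (-g))) := by
          gcongr
          exact one_add_sq_pow_le hk (by linarith) hη.le hη_upper
      _ = M * K * (k * Real.exp (-g)) := by ring
      _ ≤ (M * K) ^ 2 * T ^ 2 := by
          gcongr
          -- `M K ≥ 1`, so its square root may be replaced by `M K` itself.
          exact le_self_pow₀ (one_le_mul_of_one_le_of_one_le hM1 hK) two_ne_zero
      _ = (M * K * T) ^ 2 := by ring
  have h1 : 0 ≤ Real.exp 2 * T := by positivity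
  have h2 : 0 ≤ M * K * β := by positivity
  linarith [hnoise, hdev]
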